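/- **Setting.** Let $M\ge 2$ and $1\le K\le N$ be integers, $\mathbb F$ a finite field, and $G\in\mathbb F^{K\times N}$ a generator matrix of an $(N,K)$ MDS code (any $K$ columns of $G$ are linearly independent). The files $W_1,\dots,W_M$ are independent uniformly random matrices in $\mathbb F^{N^M\times K}$; server $l\in[0:N-1]$ stores the $l$-th column of $W_mG$ for every $m$. The desired index $\theta$ is uniform on $[1:M]$ and independent of the files. A protocol sends to server $l$ a random query $Q_l$, whose joint law depends only on $\theta$; server $l$ returns an answer $A_l$, a string over $\mathbb F$ that is a function of $Q_l$ and the stored data. The protocol is correct if the client can decode, i.e. $H(W_\theta\mid A_{[0:N-1]},Q_{[0:N-1]},\theta)=0$ (the client knows $\theta$); its rate is $R=\frac{KN^M\log|\mathbb F|}{\mathbb E[D]}$ with $D$ the total number of downloaded bits (a string of length $\ell$ counts as $\ell\log|\mathbb F|$ bits), and its mutual-information leakage is $\rho^{\mathsf{MIL}}=\frac1N\sum_{l=0}^{N-1}I(\theta;Q_l)$. Logarithms are to base $2$. **The protocol $\mathcal P_{\mathsf{WBU}}$.** Its parameter is a probability distribution $\mathsf P_{M'}$ on $[0:M-1]$.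 If $\theta=k$, the client draws $M'\sim\mathsf P_{M'}$. * If $M'=0$, it draws a uniformly random $K$-subset $S$ of the servers and asks the servers in $S$ for everything they store of file $k$; the other servers get a null query and return nothing. * If $M'=m'\neq0$, it draws a uniformly random set $J$ of $m'$ files other than $k$, and runs the Banawan–Ulukus MDS-PIR scheme for the $s=m'+1$ files $J\cup\{k\}$ with desired file $k$, where the $N^M$ rows of each file are grouped, in order, into $N^{s}$ super-rows of $N^{M-s}$ rows, which play the role of the rows. In that scheme the rows of each file are relabelled by independent, private, uniformly random permutations. There are $K$ repetitions; in each repetition every server is asked, for each nonempty set $A$ of the $s$ files, for $K^{s-|A|}(N-K)^{|A|-1}$ sums of one coded symbol of each file in $A$. Each sum not involving file $k$ is requested, for the same rows, from $K$ cyclically consecutive servers, so that the client can decode that sum of rows; the symbols that the other $N-K$ servers would return for it are used there, once each, as side information added to a new desired symbol. Within a repetition all requested desired rows are distinct; in each further repetition the same desired rows are requested from cyclically shifted servers, and new rows of the undesired files are used. The order of the sums is shuffled uniformly and independently at each server. **Theorem.** For every real $\rho\ge0$ there is a distribution $\mathsf P_{M'}$ on $[0:M-1]$, which depends only on $\rho,M,N,K$,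 such that $\mathcal P_{\mathsf{WBU}}$ with this distribution, for every $\mathbb F$ and $G$ as above, is correct and satisfies $$\rho^{\mathsf{MIL}}=\min\Bigl(\rho,\frac{K\log M}{N}\Bigr),\qquad R=\Bigl(1+\Bigl(1-\frac{N\rho}{K\log M}\Bigr)_+\Bigl(\frac KN+\cdots+\Bigl(\frac KN\Bigr)^{M-1}\Bigr)\Bigr)^{-1},$$ where $(x)_+=\max(0,x)$. If $K<N$, then moreover $H(W_\theta\mid A_{[0:N-1]},Q_{[0:N-1]})=0$. -/

import Mathlib

noncomputable section

open scoped Classical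

universe u

/-! ### Entropy and mutual information (in bits) on a finite probability space -/

namespace FinProb

variable {Ω α β : Type*} [Fintype Ω]

/-- The probability `Pr(X = x)`. -/
def prob (p : PMF Ω) (X : Ω → α) (x : α) : ℝ :=
  ∑ ω : Ω, if X ω = x then (p ω).toReal else 0

/-- The expectation of a real random variable. -/
def expect (p : PMF Ω) (X : Ω → ℝ) : ℝ :=
  ∑ ω : Ω, (p ω).toReal * X ω

/-- The Shannon entropy `H(X)`, in bits. -/
def entropy (p : PMF Ω) (X : Ω → α) : ℝ :=
  ∑ x ∈ Finset.univ.image X, prob p X x * Real.logb 2 (1 / prob p X x)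

/-- The conditional entropy `H(X | Y) = ∑ Pr(x, y) log (Pr(y) / Pr(x, y))`, in bits. -/
def condEntropy (p : PMF Ω) (X : Ω → α) (Y : Ω → β) : ℝ :=
  ∑ y ∈ Finset.univ.image Y, ∑ x ∈ Finset.univ.image X,
    prob p (fun ω => (X ω, Y ω)) (x, y) *
      Real.logb 2 (prob p Y y / prob p (fun ω => (X ω, Y ω)) (x, y))

/-- The mutual information `I(X; Y) = H(X) - H(X | Y)`, in bits. -/
def mutualInfo (p : PMF Ω) (X : Ω → α) (Y : Ω → β) : ℝ :=
  entropy p X - condEntropy p X Y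

end FinProb

/-! ### MDS-coded storage and information retrieval schemes -/

/-- `G` generates an `(N, K)` MDS code: any `K` distinct columns are linearly independent. -/
def IsMDS {F : Type u} [Field F] {K N : ℕ} (G : Matrix (Fin K) (Fin N) F) : Prop :=
  ∀ e : Fin K ↪ Fin N, LinearIndependent F (fun i => G.col (e i))

/-- The contents of server `l`: column `l` of every encoded file `W m * G`. -/
def stored {F : Type u} [Field F] {K N L M : ℕ} (G : Matrix (Fin K) (Fin N) F)
    (W : Fin M → Matrix (Fin L) (Fin K) F) (l : Fin N) : Fin M → Fin L → F :=
  fun m r => (W m * G) r l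

/-- An information retrieval protocol for `M` files on `N` servers, each of which stores `L` symbols
of `F` per file. The query vector is random, with a law that depends on the index of the
desired file; an answer is a string over `F`, a function of the query and the stored data. -/
structure IRScheme (M N L : ℕ) (F : Type u) where
  Query : Type
  [fintypeQuery : Fintype Query]
  queryLaw : Fin M → PMF (Fin N → Query)
  answer : Fin N → Query → (Fin M → Fin L → F) → List F

attribute [instance] IRScheme.fintypeQuery

namespace IRScheme

variable {M N L : ℕ} {F : Type u}

/-- The joint law of the desired index `θ` (uniform), the files (all symbols independent and
uniform, independent of the rest) and the queries. -/
def law [NeZero M] [Field F] [Fintype F] (C : IRScheme M N L F) (K : ℕ) :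
    PMF (Fin M × (Fin M → Matrix (Fin L) (Fin K) F) × (Fin N → C.Query)) :=
  (PMF.uniformOfFintype (Fin M)).bind fun θ =>
    (PMF.uniformOfFintype (Fin M → Matrix (Fin L) (Fin K) F)).bind fun W =>
      (C.queryLaw θ).map fun q => (θ, W, q)

/-- The vector of all answers when the files are `W` and the queries are `q`. -/
def answers [Field F] (C : IRScheme M N L F) {K : ℕ} (G : Matrix (Fin K) (Fin N) F)
    (W : Fin M → Matrix (Fin L) (Fin K) F) (q : Fin N → C.Query) : Fin N → List F :=
  fun l => C.answer l (q l) (stored G W l)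

/-- `H(W_θ | A_{[0:N-1]}, Q_{[0:N-1]})`. -/
def residualEntropy [NeZero M] [Field F] [Fintype F] (C : IRScheme M N L F) {K : ℕ}
    (G : Matrix (Fin K) (Fin N) F) : ℝ :=
  FinProb.condEntropy (C.law K) (fun ω => ω.2.1 ω.1)
    (fun ω => (C.answers G ω.2.1 ω.2.2, ω.2.2))

/-- `H(W_θ | A_{[0:N-1]}, Q_{[0:N-1]}, θ)`: the uncertainty that is left to the client, who knows
its own index `θ`. -/
def clientResidualEntropy [NeZero M] [Field F] [Fintype F] (C : IRScheme M N L F) {K : ℕ}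
    (G : Matrix (Fin K) (Fin N) F) : ℝ :=
  FinProb.condEntropy (C.law K) (fun ω => ω.2.1 ω.1)
    (fun ω => (C.answers G ω.2.1 ω.2.2, ω.2.2, ω.1))

/-- The rate: the size of a file in bits over the expected number of downloaded bits. -/
def rate [NeZero M] [Field F] [Fintype F] (C : IRScheme M N L F) {K : ℕ}
    (G : Matrix (Fin K) (Fin N) F) : ℝ :=
  ((L * K : ℕ) : ℝ) * Real.logb 2 (Fintype.card F) /
    FinProb.expect (C.law K) (fun ω =>
      ∑ l, ((C.answers G ω.2.1 ω.2.2 l).length : ℝ) * Real.logb 2 (Fintype.card F))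

/-- The joint law of `θ` and the queries. -/
def indexQueryLaw [NeZero M] (C : IRScheme M N L F) : PMF (Fin M × (Fin N → C.Query)) :=
  (PMF.uniformOfFintype (Fin M)).bind fun θ => (C.queryLaw θ).map fun q => (θ, q)

/-- The mutual information leakage `(1 / N) ∑_l I(θ; Q_l)`. -/
def mil [NeZero M] (C : IRScheme M N L F) : ℝ :=
  (1 / (N : ℝ)) * ∑ l, FinProb.mutualInfo C.indexQueryLaw (fun ω => ω.1) (fun ω => ω.2 l)

end IRScheme

/-! ### The Banawan–Ulukus scheme on `s` files

There are `K` repetitions. In each repetition every server is asked, for every nonempty set `A`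
of files, for `K ^ (s - |A|) * (N - K) ^ (|A| - 1)` sums of one coded symbol of each file in `A`.
These sums are enumerated by words over `Fin N` on the files other than `min A`, in which exactly
the files in `A` have a letter `≥ K`. The `N ^ s` rows of each file carry private labels in
`Fin s → Fin N`, assigned by a uniformly random bijection.

* The rows of the desired file are pairwise distinct within a repetition; the next repetition asks
  for the same rows, with the servers shifted cyclically.
* The sums that do not involve the desired file come in groups of `K`: the servers
  `b, b + 1, …, b + K - 1` (mod `N`) are asked for the same sum of rows. The client can then decode
  this sum of rows, and so knows the coded symbol that each of the `N - K` other servers would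
  return. At each of these servers the symbol is added, as side information, to a new symbol of
  the desired file. Every repetition uses new rows of the undesired files. -/

namespace BU

/-- The sums that one server is asked for in one repetition: a nonempty set `A` of files and
a word on the files other than `min A` (its unused entry at `min A` is set to `0`). -/
abbrev Slot (N K s : ℕ) : Type :=
  {x : Finset (Fin s) × (Fin s → Fin N) //
    ∃ h : x.1.Nonempty, ((x.2 (x.1.min' h) : Fin N) : ℕ) = 0 ∧
      ∀ i, i ≠ x.1.min' h → (i ∈ x.1 ↔ K ≤ (x.2 i : ℕ))}

/-- All sums that one server is asked for: a repetition `c < K` and a slot. -/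
abbrev Pos (N K s : ℕ) : Type := {c : Fin N // (c : ℕ) < K} × Slot N K s

/-- The word of a slot, rewritten so that the unused entry is at the desired file `k`
if `k` belongs to `A`. -/
def relead {N s : ℕ} (k : Fin s) (A : Finset (Fin s)) (hA : A.Nonempty) (z : Fin s → Fin N) :
    Fin s → Fin N :=
  if k ∈ A then z ∘ Equiv.swap (A.min' hA) k else z

/-- The label of the row of file `j ∈ A` in the sum that server `n` is asked for in repetition `c`
at slot `(A, z)`, if `k` is the desired file.

For `j = k` it consists of the word of the slot and, at `k`, the server `n - c`.
For `j ≠ k` it describes the group: the set `B = A \ {k}` and the remaining word, the first server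
`b` of the group at `j`, and the repetition `c` at `k`. Here `n - b` is a letter
of the word: it is less than `K` if `k ∉ A`, and at least `K` (side information) if `k ∈ A`. -/
def label {N s : ℕ} (k : Fin s) (n c : Fin N) (A : Finset (Fin s)) (z : Fin s → Fin N)
    (j : Fin s) (hj : j ∈ A) : Fin s → Fin N :=
  let x := relead k A ⟨j, hj⟩ z
  if hk : j = k then Function.update x k (n - c)
  else
    let j₀ := (A.erase k).min' ⟨j, Finset.mem_erase.mpr ⟨hk, hj⟩⟩
    let b := n - (if k ∈ A then x j₀ else x k)
    Function.update (Function.update x j₀ b) k c ∘ Equiv.swap j₀ j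

/-- The law of the queries on `s` files with desired file `k`. Every file gets an independent,
uniformly random bijection `π j` from labels to rows, and the order of the sums at every server is
shuffled uniformly by `σ l`. A query lists, for each sum, the files involved and their rows. -/
def queryLaw (N K s : ℕ) (k : Fin s) :
    PMF (Fin N → Pos N K s → Fin s → Option (Fin (N ^ s))) :=
  haveI : Nonempty (Fin s → ((Fin s → Fin N) ≃ Fin (N ^ s))) := ⟨fun _ => finFunctionFinEquiv⟩
  haveI : Fintype (Fin N → Equiv.Perm (Pos N K s)) := Fintype.ofFinite _
  (PMF.uniformOfFintype (Fin s → ((Fin s → Fin N) ≃ Fin (N ^ s)))).bind fun π =>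
    (PMF.uniformOfFintype (Fin N → Equiv.Perm (Pos N K s))).map fun σ =>
      fun l τ j =>
        let c : Fin N := (σ l τ).1.1
        let A : Finset (Fin s) := (σ l τ).2.1.1
        let z : Fin s → Fin N := (σ l τ).2.1.2
        if hj : j ∈ A then some (π j (label k l c A z j hj)) else none

end BU

/-! ### The weakly private scheme -/

namespace WBU

/-- The queries: `null`; `clean k`, the request for everything stored of file `k`; and `sums m' q`,
a query on `m' + 1` files with `(m' + 1)`-level super-segmentation, which lists, for each
requested sum, the files involved and their super-rows. -/
inductive Query (M N K : ℕ) : Type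
  | null : Query M N K
  | clean (k : Fin M) : Query M N K
  | sums (m' : Fin M)
      (q : BU.Pos N K (m' + 1) → Fin M → Option (Fin (N ^ ((m' : ℕ) + 1)))) : Query M N K

/-- The finitely many queries, as a sum type. -/
def Query.code {M N K : ℕ} : Query M N K → Option (Fin M ⊕
    (m' : Fin M) × (BU.Pos N K (m' + 1) → Fin M → Option (Fin (N ^ ((m' : ℕ) + 1)))))
  | .null => none
  | .clean k => some (Sum.inl k)
  | .sums m' q => some (Sum.inr ⟨m', q⟩)

theorem Query.code_injective {M N K : ℕ} :
    Function.Injective (Query.code : Query M N K → _) := by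
  intro a b h
  cases a <;> cases b <;> simp [Query.code] at h ⊢ <;> exact h

instance (M N K : ℕ) : Fintype (Query M N K) := Fintype.ofInjective _ Query.code_injective

/-- For `s`-level super-segmentation, the `t`-th row of super-row `r`: the `N ^ M` rows are
cut, in order, into `N ^ s` super-rows of `N ^ (M - s)` rows each. -/
def superRow {M N s : ℕ} (hs : s ≤ M) (r : Fin (N ^ s)) (t : Fin (N ^ (M - s))) : Fin (N ^ M) :=
  Fin.cast (pow_mul_pow_sub N hs) (finProdFinEquiv (r, t))

/-- The answer of a server that stores the symbols `X`. -/
def answer {M N K : ℕ} {F : Type u} [Field F] :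
    Query M N K → (Fin M → Fin (N ^ M) → F) → List F
  | .null, _ => []
  | .clean k, X => List.ofFn (X k)
  | .sums m' q, X =>
      (Finset.univ : Finset (BU.Pos N K (m' + 1) × Fin (N ^ (M - ((m' : ℕ) + 1))))).toList.map
        fun x => ∑ i : Fin M, match q x.1 i with
          | none => 0
          | some r => X i (superRow m'.isLt r x.2)

/-- The sets of `m'` undesired files. -/
abbrev Others {M : ℕ} (k m' : Fin M) : Type :=
  {J : Finset (Fin M) // k ∉ J ∧ J.card = (m' : ℕ)}

theorem others_nonempty {M : ℕ} (k m' : Fin M) : Nonempty (Others k m') := by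
  have h : (m' : ℕ) ≤ (Finset.univ.erase k : Finset (Fin M)).card := by
    rw [Finset.card_erase_of_mem (Finset.mem_univ k), Finset.card_univ, Fintype.card_fin]
    exact Nat.le_sub_one_of_lt m'.isLt
  obtain ⟨J, hJ, hc⟩ := Finset.exists_subset_card_eq h
  exact ⟨J, fun hk => by simpa using hJ hk, hc⟩

theorem subsets_nonempty {N K : ℕ} (h : K ≤ N) :
    Nonempty {S : Finset (Fin N) // S.card = K} := by
  obtain ⟨S, -, hS⟩ := Finset.exists_subset_card_eq
    (s := (Finset.univ : Finset (Fin N))) (n := K) (by simpa using h)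
  exact ⟨S, hS⟩

/-- The files in `J ∪ {k}`, numbered in increasing order. -/
def numbering {M : ℕ} {k m' : Fin M} (J : Others k m') :
    Fin ((m' : ℕ) + 1) ≃ {i : Fin M // i ∈ insert k J.1} :=
  ((insert k J.1).orderIsoOfFin
    (by rw [Finset.card_insert_of_notMem J.2.1, J.2.2])).toEquiv

/-- The law of the queries for the desired file `k`, if the number `M'` of additional files has
law `P`. -/
def queryLaw {M N K : ℕ} (hKN : K ≤ N) (P : PMF (Fin M)) (k : Fin M) :
    PMF (Fin N → Query M N K) :=
  P.bind fun m' =>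
    if (m' : ℕ) = 0 then
      haveI := subsets_nonempty hKN
      (PMF.uniformOfFintype {S : Finset (Fin N) // S.card = K}).map fun S l =>
        if l ∈ S.1 then Query.clean k else Query.null
    else
      haveI := others_nonempty k m'
      (PMF.uniformOfFintype (Others k m')).bind fun J =>
        (BU.queryLaw N K ((m' : ℕ) + 1)
            ((numbering J).symm ⟨k, Finset.mem_insert_self k J.1⟩)).map fun q l =>
          Query.sums m' fun τ i =>
            if hi : i ∈ insert k J.1 then q l τ ((numbering J).symm ⟨i, hi⟩) else none

/-- The protocol with law `P` of `M'`, for files of `N ^ M` rows. -/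
def scheme (M N K : ℕ) (F : Type u) [Field F] (hKN : K ≤ N) (P : PMF (Fin M)) :
    IRScheme M N (N ^ M) F where
  Query := Query M N K
  queryLaw := queryLaw hKN P
  answer := fun _ => answer

end WBU

end

/-! Only two values of $M'$ are needed: $M'=0$ with probability $p=\min(1,N\rho/(K\log M))$, and
$M'=M-1$ otherwise.

Leakage. Given $M'=M-1$, all files take part, and the query to one server has the same law for every
desired file (`BU.queryLaw_map_apply_eq`): for each file that server sees distinct rows under
uniformly random private labels. Given $M'=0$, a null query is equally likely for every desired
file, while each of the $K$ clean queries reveals it. So $I(\theta;Q_l)$ is $\log M$ times the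
probability of a clean query (`FinProb.mutualInfo_of_reveal`), and the average over the servers is
$pK\log M/N$.

Rate. $M'=0$ costs $KN^M$ symbols; $M'=M-1$ costs $KN^M\sum_{i<M}(K/N)^i$, by a count of the slots
(`BU.card_slot`).

Correctness holds for every law of $M'$. By linearity it suffices that vanishing answers force the
desired rows to vanish (`BU.eq_zero_of_sums_eq_zero`). The MDS property is used twice: $K$ servers
of a group determine the side information, and after its removal $K$ consecutive servers determine a
desired row.

If $K<N$, the queries show which file is desired (`WBU.index_unique`). Rows of an undesired file are
requested from all servers or from none, whereas some row of the desired file is requested from some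
servers only. The client then needs no separate knowledge of $\theta$. -/

noncomputable section

open scoped Classical

universe u

/-! ### Expectation, entropy and mutual information on a finite space -/

namespace FinProb

variable {Ω Ω' α β : Type*} [Fintype Ω] [Fintype Ω']

theorem sum_toReal_eq_one (p : PMF Ω) : ∑ ω, (p ω).toReal = 1 := by
  rw [← ENNReal.toReal_sum (fun ω _ => p.apply_ne_top ω), ← tsum_fintype (L := .unconditional _),
    p.tsum_coe, ENNReal.toReal_one]

theorem expect_const (p : PMF Ω) (c : ℝ) : expect p (fun _ => c) = c := by
  rw [expect, ← Finset.sum_mul, sum_toReal_eq_one, one_mul]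

theorem expect_congr {p : PMF Ω} {f g : Ω → ℝ} (h : ∀ ω ∈ p.support, f ω = g ω) :
    expect p f = expect p g := by
  refine Finset.sum_congr rfl fun ω _ => ?_
  by_cases hω : p ω = 0
  · simp [hω]
  · rw [h ω hω]

theorem expect_sub (p : PMF Ω) (f g : Ω → ℝ) :
    expect p (fun ω => f ω - g ω) = expect p f - expect p g := by
  simp only [expect, mul_sub, Finset.sum_sub_distrib]

theorem expect_sum {ι : Type*} (s : Finset ι) (p : PMF Ω) (f : ι → Ω → ℝ) :
    expect p (fun ω => ∑ i ∈ s, f i ω) = ∑ i ∈ s, expect p (f i) := by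
  simp only [expect, Finset.mul_sum]
  exact Finset.sum_comm

theorem expect_mul_const (p : PMF Ω) (f : Ω → ℝ) (c : ℝ) :
    expect p (fun ω => f ω * c) = expect p f * c := by
  simp only [expect, Finset.sum_mul, mul_assoc]

theorem expect_bind (p : PMF Ω) (g : Ω → PMF Ω') (f : Ω' → ℝ) :
    expect (p.bind g) f = expect p (fun ω => expect (g ω) f) := by
  have h (b : Ω') : (p.bind g b).toReal = ∑ a, (p a).toReal * (g a b).toReal := by
    rw [PMF.bind_apply, tsum_fintype, ENNReal.toReal_sum]
    · simp only [ENNReal.toReal_mul]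
    · exact fun a _ => ENNReal.mul_ne_top (p.apply_ne_top a) ((g a).apply_ne_top b)
  simp only [expect, h, Finset.sum_mul, Finset.mul_sum, mul_assoc]
  exact Finset.sum_comm

theorem expect_pure (a : Ω) (f : Ω → ℝ) : expect (PMF.pure a) f = f a := by
  rw [expect, Finset.sum_eq_single a]
  · simp
  · intro b _ hb
    simp [hb]
  · simp

theorem expect_map (p : PMF Ω) (g : Ω → Ω') (f : Ω' → ℝ) :
    expect (p.map g) f = expect p (fun ω => f (g ω)) := by
  rw [← PMF.bind_pure_comp, expect_bind]
  simp only [Function.comp_apply, expect_pure]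

theorem expect_uniform [Nonempty Ω] (f : Ω → ℝ) :
    expect (PMF.uniformOfFintype Ω) f = (1 / (Fintype.card Ω : ℝ)) * ∑ ω, f ω := by
  simp [expect, Finset.mul_sum]

theorem prob_eq_expect (p : PMF Ω) (X : Ω → α) (x : α) :
    prob p X x = expect p (fun ω => if X ω = x then 1 else 0) := by
  simp [prob, expect]

theorem prob_eq_zero {p : PMF Ω} {X : Ω → α} {x : α} (h : ∀ ω ∈ p.support, X ω ≠ x) :
    prob p X x = 0 := by
  rw [prob_eq_expect]
  exact (expect_congr fun ω hω => if_neg (h ω hω)).trans (expect_const p 0)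

theorem expect_comp (p : PMF Ω) (Y : Ω → β) (f : β → ℝ) :
    expect p (fun ω => f (Y ω)) = ∑ y ∈ Finset.univ.image Y, prob p Y y * f y := by
  simp only [prob, Finset.sum_mul]
  rw [Finset.sum_comm]
  refine Finset.sum_congr rfl fun ω _ => ?_
  rw [Finset.sum_eq_single (Y ω)]
  · simp
  · intro b _ hb
    simp [hb.symm]
  · simp

theorem sum_prob_pair (p : PMF Ω) (X : Ω → α) (Y : Ω → β) (y : β) :
    ∑ x ∈ Finset.univ.image X, prob p (fun ω => (X ω, Y ω)) (x, y) = prob p Y y := by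
  simp only [prob]
  rw [Finset.sum_comm]
  refine Finset.sum_congr rfl fun ω _ => ?_
  rw [Finset.sum_eq_single (X ω)]
  · simp
  · intro b _ hb
    simp [hb.symm]
  · simp

/-- If `X` is a function of `Y` almost surely, then `H(X | Y) = 0`. -/
theorem condEntropy_eq_zero {p : PMF Ω} {X : Ω → α} {Y : Ω → β}
    (h : ∀ ω ∈ p.support, ∀ ω' ∈ p.support, Y ω = Y ω' → X ω = X ω') :
    condEntropy p X Y = 0 := by
  refine Finset.sum_eq_zero fun y _ => Finset.sum_eq_zero fun x _ => ?_
  by_cases hxy : ∃ ω ∈ p.support, X ω = x ∧ Y ω = y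
  · obtain ⟨ω, hω, rfl, rfl⟩ := hxy
    have : prob p (fun ω => (X ω, Y ω)) (X ω, Y ω) = prob p Y (Y ω) := by
      simp only [prob_eq_expect, Prod.mk.injEq]
      refine expect_congr fun ω' hω' => if_congr ?_ rfl rfl
      exact ⟨fun h' => h'.2, fun h' => ⟨h ω' hω' ω hω h', h'⟩⟩
    rw [this]
    by_cases h0 : prob p Y (Y ω) = 0
    · simp [h0]
    · simp [div_self h0]
  · rw [prob_eq_zero, zero_mul]
    intro ω hω he
    rw [Prod.mk.injEq] at he
    exact hxy ⟨ω, hω, he⟩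

/-- If `X` is uniform and every value of `Y` is either uninformative or reveals `X`, then
`I(X; Y)` is `H(X)` times the probability of a revealing value. -/
theorem mutualInfo_of_reveal {ι : Type*} [Fintype ι] [Nonempty ι] {p : PMF Ω}
    {X : Ω → ι} {Y : Ω → β}
    (hX : ∀ x, prob p X x = 1 / Fintype.card ι) (C : β → Prop)
    (hC : ∀ y, C y → ∃ k, ∀ x, x ≠ k → prob p (fun ω => (X ω, Y ω)) (x, y) = 0)
    (hnC : ∀ y, ¬ C y → ∀ x x',
      prob p (fun ω => (X ω, Y ω)) (x, y) = prob p (fun ω => (X ω, Y ω)) (x', y)) :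
    mutualInfo p X Y =
      Real.logb 2 (Fintype.card ι) * expect p (fun ω => if C (Y ω) then 1 else 0) := by
  have hcard : (Fintype.card ι : ℝ) ≠ 0 := by simp
  -- A value outside the image would have probability zero instead of `1 / card ι`.
  have himage : Finset.univ.image X = Finset.univ := by
    refine Finset.eq_univ_of_forall fun x => ?_
    by_contra hx
    have : prob p X x = 0 := prob_eq_zero fun ω _ he => hx (by simp [← he])
    rw [hX] at this
    simp at this
  have hent : entropy p X = Real.logb 2 (Fintype.card ι) := by
    rw [entropy, himage]
    simp only [hX, one_div_one_div, Finset.sum_const, Finset.card_univ, nsmul_eq_mul]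
    field_simp
  have hcond : condEntropy p X Y =
      Real.logb 2 (Fintype.card ι) * expect p (fun ω => if C (Y ω) then 0 else 1) := by
    rw [expect_comp p Y (fun y => if C y then 0 else 1), condEntropy, Finset.mul_sum]
    refine Finset.sum_congr rfl fun y _ => ?_
    have hsum := sum_prob_pair p X Y y
    rw [himage] at hsum ⊢
    -- A revealing `y` contributes nothing to `H(X | Y)`; given any other `y`, `X` is still uniform
    -- and the contribution is `Pr(y) * log (card ι)`.
    by_cases hy : C y
    · obtain ⟨k, hk⟩ := hC y hy
      rw [if_pos hy, mul_zero, mul_zero]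
      refine Finset.sum_eq_zero fun x _ => ?_
      by_cases hx : x = k
      · subst hx
        rw [Finset.sum_eq_single x (fun b _ hb => hk b hb) (by simp)] at hsum
        rw [hsum]
        by_cases h0 : prob p Y y = 0
        · simp [h0]
        · simp [div_self h0]
      · rw [hk x hx, zero_mul]
    · have hconst (x : ι) : prob p (fun ω => (X ω, Y ω)) (x, y) =
          prob p Y y / Fintype.card ι := by
        rw [Finset.sum_congr rfl (fun x' _ => hnC y hy x' x)] at hsum
        rw [← hsum, Finset.sum_const, Finset.card_univ, nsmul_eq_mul]
        field_simp
      simp only [hconst, if_neg hy, mul_one, Finset.sum_const, Finset.card_univ, nsmul_eq_mul]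
      by_cases h0 : prob p Y y = 0
      · simp [h0]
      · rw [div_div_cancel₀ h0]
        field_simp
  rw [mutualInfo, hent, hcond]
  have : expect p (fun ω => if C (Y ω) then (1 : ℝ) else 0) =
      1 - expect p (fun ω => if C (Y ω) then (0 : ℝ) else 1) := by
    rw [← expect_const p 1, ← expect_sub, expect_const]
    refine expect_congr fun ω _ => ?_
    split_ifs <;> simp
  rw [this]
  ring

end FinProb

theorem Finset.nonempty_of_mem {α : Type*} {A : Finset α} {j : α} (hj : j ∈ A) : A.Nonempty :=
  ⟨j, hj⟩

/-! ### Combinatorics of slots and labels -/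

namespace BU

variable {N K s : ℕ}

/-- The pairs `(A, z)` that make up `Slot N K s`. -/
def IsSlot (K : ℕ) (A : Finset (Fin s)) (z : Fin s → Fin N) : Prop :=
  ∃ h : A.Nonempty, ((z (A.min' h) : Fin N) : ℕ) = 0 ∧
    ∀ i, i ≠ A.min' h → (i ∈ A ↔ K ≤ (z i : ℕ))

theorem relead_of_notMem {k : Fin s} {A : Finset (Fin s)} (hk : k ∉ A) (hA : A.Nonempty)
    (z : Fin s → Fin N) : relead k A hA z = z := if_neg hk

theorem IsSlot.relead_self {k : Fin s} {A : Finset (Fin s)} {z : Fin s → Fin N}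
    (h : IsSlot K A z) (hk : k ∈ A) (hA : A.Nonempty) : (relead k A hA z k : ℕ) = 0 := by
  obtain ⟨h₁, h₂, -⟩ := h
  simpa [relead, hk] using h₂

/-- The swap exchanges the entries at `min A` and `k`, which both belong to `A`. The membership test
by letters therefore survives, with `k` instead of `min A` as the exempt position. -/
theorem IsSlot.mem_iff_relead {k : Fin s} {A : Finset (Fin s)} {z : Fin s → Fin N}
    (h : IsSlot K A z) (hk : k ∈ A) (hA : A.Nonempty) {i : Fin s} (hi : i ≠ k) :
    i ∈ A ↔ K ≤ (relead k A hA z i : ℕ) := by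
  obtain ⟨h₁, -, h₃⟩ := h
  rw [relead, if_pos hk, Function.comp_apply]
  by_cases him : i = A.min' hA
  · subst him
    rw [Equiv.swap_apply_left, ← h₃ k hi.symm]
    simp [hk, Finset.min'_mem]
  · rw [Equiv.swap_apply_of_ne_of_ne him hi]
    exact h₃ i him

theorem relead_relead {k : Fin s} {A : Finset (Fin s)} (hA : A.Nonempty) (z : Fin s → Fin N) :
    relead k A hA (relead k A hA z) = z := by
  unfold relead
  split_ifs
  · rw [Function.comp_assoc]
    ext i
    simp
  · rfl

theorem IsSlot.mem_iff_relead_of_ne {k : Fin s} {A : Finset (Fin s)} {z : Fin s → Fin N}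
    (h : IsSlot K A z) (hA : A.Nonempty) (hB : (A.erase k).Nonempty) {i : Fin s} (hik : i ≠ k)
    (him : i ≠ (A.erase k).min' hB) : i ∈ A ↔ K ≤ (relead k A hA z i : ℕ) := by
  by_cases hk : k ∈ A
  · exact h.mem_iff_relead hk _ hik
  · rw [relead_of_notMem hk]
    obtain ⟨h₁, -, h₃⟩ := h
    refine h₃ i fun he => him ?_
    rw [he]
    congr 1
    exact (Finset.erase_eq_of_notMem hk).symm

theorem isSlot_relead {k : Fin s} {A : Finset (Fin s)} {x : Fin s → Fin N} (hk : k ∈ A)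
    (hA : A.Nonempty) (h0 : (x k : ℕ) = 0) (hx : ∀ i, i ≠ k → (i ∈ A ↔ K ≤ (x i : ℕ))) :
    IsSlot K A (relead k A hA x) := by
  refine ⟨hA, by simpa [relead, hk] using h0, fun i hi => ?_⟩
  rw [relead, if_pos hk, Function.comp_apply]
  by_cases hik : i = k
  · subst hik
    rw [Equiv.swap_apply_right, ← hx _ hi.symm]
    simp [hk, Finset.min'_mem]
  · rw [Equiv.swap_apply_of_ne_of_ne hi hik]
    exact hx i hik

theorem label_self (k : Fin s) (n c : Fin N) (A : Finset (Fin s)) (z : Fin s → Fin N)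
    (hk : k ∈ A) :
    label k n c A z k hk = Function.update (relead k A (Finset.nonempty_of_mem hk) z) k (n - c) := by
  simp [label]

/-- The first server of the group of the sum over `A \ {k}`. -/
def groupStart (k : Fin s) (n : Fin N) (A B : Finset (Fin s)) (hB : B.Nonempty)
    (x : Fin s → Fin N) : Fin N :=
  n - if k ∈ A then x (B.min' hB) else x k

/-- The label of an undesired file, in terms of the set `B` of undesired files of the sum. -/
theorem label_of_ne {k : Fin s} (n c : Fin N) {A B : Finset (Fin s)} (z : Fin s → Fin N)
    {j : Fin s} (hj : j ∈ A) (hjk : j ≠ k) (hAB : A.erase k = B) (hB : B.Nonempty) :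
    label k n c A z j hj =
      Function.update (Function.update (relead k A (Finset.nonempty_of_mem hj) z) (B.min' hB)
        (groupStart k n A B hB (relead k A (Finset.nonempty_of_mem hj) z))) k c ∘ Equiv.swap (B.min' hB) j := by
  subst hAB
  simp [label, hjk, groupStart]

theorem label_of_ne_apply_desired {k : Fin s} (n c : Fin N) {A : Finset (Fin s)}
    (z : Fin s → Fin N) {j : Fin s} (hj : j ∈ A) (hjk : j ≠ k) :
    label k n c A z j hj k = c := by
  have hB : (A.erase k).Nonempty := ⟨j, Finset.mem_erase.2 ⟨hjk, hj⟩⟩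
  have hm : (A.erase k).min' hB ≠ k := Finset.ne_of_mem_erase (Finset.min'_mem _ hB)
  rw [label_of_ne n c z hj hjk rfl hB, Function.comp_apply,
    Equiv.swap_apply_of_ne_of_ne hm.symm hjk.symm, Function.update_self]

theorem label_of_ne_apply_self {k : Fin s} (n c : Fin N) {A : Finset (Fin s)}
    (z : Fin s → Fin N) {j : Fin s} (hj : j ∈ A) (hjk : j ≠ k) (hB : (A.erase k).Nonempty) :
    label k n c A z j hj j =
      groupStart k n A (A.erase k) hB (relead k A (Finset.nonempty_of_mem hj) z) := by
  have hm : (A.erase k).min' hB ≠ k := Finset.ne_of_mem_erase (Finset.min'_mem _ hB)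
  rw [label_of_ne n c z hj hjk rfl hB, Function.comp_apply,
    Equiv.swap_apply_right, Function.update_of_ne hm, Function.update_self]

/-- Away from `k` and `j` the label shows the letters of the releaded word, except that the entry at
`min (A \ {k})` is replaced by the one at `j`; both files are in `A`, so the test is unaffected. -/
theorem IsSlot.mem_iff_label {k : Fin s} (n c : Fin N) {A : Finset (Fin s)}
    {z : Fin s → Fin N} (h : IsSlot K A z) {j : Fin s} (hj : j ∈ A) (hjk : j ≠ k)
    {i : Fin s} (hik : i ≠ k) (hij : i ≠ j) :
    i ∈ A ↔ K ≤ (label k n c A z j hj i : ℕ) := by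
  have hB : (A.erase k).Nonempty := ⟨j, Finset.mem_erase.2 ⟨hjk, hj⟩⟩
  have hmem := Finset.min'_mem _ hB
  have hm : (A.erase k).min' hB ≠ k := Finset.ne_of_mem_erase hmem
  rw [label_of_ne n c z hj hjk rfl hB, Function.comp_apply]
  by_cases him : i = (A.erase k).min' hB
  · rw [him, Equiv.swap_apply_left, Function.update_of_ne hjk,
      Function.update_of_ne (fun he => hij (him.trans he.symm)),
      ← h.mem_iff_relead_of_ne _ hB hjk (fun he => hij (him.trans he.symm))]
    simp [hj, Finset.mem_of_mem_erase hmem]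
  · rw [Equiv.swap_apply_of_ne_of_ne him hij, Function.update_of_ne hik,
      Function.update_of_ne him]
    exact h.mem_iff_relead_of_ne _ hB hik him

/-- The entry at `j` is the first server of the group. The offset of `n` from it is a letter of the
word, and this letter is `< K` at the servers that serve for decoding, `≥ K` at those that use side
information. -/
theorem IsSlot.mem_desired_iff [NeZero N] {k : Fin s} (n c : Fin N) {A : Finset (Fin s)}
    {z : Fin s → Fin N} (h : IsSlot K A z) {j : Fin s} (hj : j ∈ A) (hjk : j ≠ k) :
    k ∈ A ↔ K ≤ ((n - label k n c A z j hj j : Fin N) : ℕ) := by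
  have hB : (A.erase k).Nonempty := ⟨j, Finset.mem_erase.2 ⟨hjk, hj⟩⟩
  have hmem := Finset.min'_mem _ hB
  rw [label_of_ne_apply_self n c z hj hjk hB, groupStart, sub_sub_cancel]
  by_cases hk : k ∈ A
  · rw [if_pos hk, ← h.mem_iff_relead hk _ (Finset.ne_of_mem_erase hmem)]
    simp [hk, Finset.mem_of_mem_erase hmem]
  · rw [if_neg hk, relead_of_notMem hk]
    obtain ⟨h₁, -, h₃⟩ := h
    exact h₃ k fun he => hk (he ▸ Finset.min'_mem _ _)

/-- A server is never asked for the same row of a file twice. -/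
theorem label_injective [NeZero N] {k : Fin s} {n c c' : Fin N} {A A' : Finset (Fin s)}
    {z z' : Fin s → Fin N} (h : IsSlot K A z) (h' : IsSlot K A' z') {j : Fin s}
    (hj : j ∈ A) (hj' : j ∈ A') (he : label k n c A z j hj = label k n c' A' z' j hj') :
    c = c' ∧ A = A' ∧ z = z' := by
  -- For the desired file, the letters away from `k` give `A` and the word, and the entry `n - c` at
  -- `k` gives `c`.
  by_cases hjk : j = k
  · subst hjk
    have hx (i : Fin s) (hi : i ≠ j) :
        relead j A (Finset.nonempty_of_mem hj) z i = relead j A' (Finset.nonempty_of_mem hj') z' i := by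
      simpa [label_self, hi] using congrFun he i
    have hA : A = A' := by
      ext i
      by_cases hi : i = j
      · simp [hi, hj, hj']
      · rw [h.mem_iff_relead hj (Finset.nonempty_of_mem hj) hi, hx i hi, ← h'.mem_iff_relead hj' _ hi]
    subst hA
    refine ⟨by simpa [label_self] using congrFun he j, rfl, ?_⟩
    rw [← relead_relead (k := j) (Finset.nonempty_of_mem hj) z, ← relead_relead (k := j) (Finset.nonempty_of_mem hj) z']
    congr 1
    ext i
    by_cases hi : i = j
    · rw [hi, h.relead_self hj, h'.relead_self hj]
    · rw [hx i hi]
  -- For an undesired file, `c` is read at `k`, the membership of `k` at `j`, and the rest of `A` at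
  -- the other positions.
  · have hc : c = c' := by
      rw [← label_of_ne_apply_desired n c z hj hjk, he, label_of_ne_apply_desired _ _ _ _ hjk]
    have hkA : k ∈ A ↔ k ∈ A' := by
      rw [h.mem_desired_iff n c hj hjk, he, ← h'.mem_desired_iff n c' hj' hjk]
    have hA : A = A' := by
      ext i
      by_cases hik : i = k
      · rw [hik, hkA]
      by_cases hij : i = j
      · simp [hij, hj, hj']
      · rw [h.mem_iff_label n c hj hjk hik hij, he, ← h'.mem_iff_label n c' hj' hjk hik hij]
    subst hA hc
    refine ⟨rfl, rfl, ?_⟩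
    have hB : (A.erase k).Nonempty := ⟨j, Finset.mem_erase.2 ⟨hjk, hj⟩⟩
    have hm : (A.erase k).min' hB ≠ k := Finset.ne_of_mem_erase (Finset.min'_mem _ hB)
    -- Equal group starts give equal offsets: this recovers the letter at `min (A \ {k})` if `k ∈
    -- A`, and the letter at `k` otherwise. The one letter still missing is the unused `0`.
    have hb := congrFun he j
    rw [label_of_ne_apply_self n c z hj hjk hB, label_of_ne_apply_self n c z' hj hjk hB,
      groupStart, groupStart, sub_right_inj] at hb
    rw [label_of_ne n c z hj hjk rfl hB, label_of_ne n c z' hj hjk rfl hB] at he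
    have he' := (Equiv.surjective _).injective_comp_right he
    have hx (i : Fin s) (hik : i ≠ k) (him : i ≠ (A.erase k).min' hB) :
        relead k A (Finset.nonempty_of_mem hj) z i = relead k A (Finset.nonempty_of_mem hj) z' i := by
      simpa [hik, him] using congrFun he' i
    rw [← relead_relead (k := k) (Finset.nonempty_of_mem hj) z, ← relead_relead (k := k) (Finset.nonempty_of_mem hj) z']
    congr 1
    ext i
    by_cases hk : k ∈ A
    · rw [if_pos hk, if_pos hk] at hb
      by_cases hik : i = k
      · rw [hik, h.relead_self hk, h'.relead_self hk]
      by_cases him : i = (A.erase k).min' hB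
      · rw [him, hb]
      · rw [hx i hik him]
    · rw [if_neg hk, if_neg hk] at hb
      by_cases hik : i = k
      · rw [hik, hb]
      by_cases him : i = (A.erase k).min' hB
      · have him' : i = A.min' (Finset.nonempty_of_mem hj) := by
          rw [him]
          congr 1
          exact Finset.erase_eq_of_notMem hk
        obtain ⟨_, h₂, -⟩ := h
        obtain ⟨_, h₂', -⟩ := h'
        rw [relead_of_notMem hk, relead_of_notMem hk, him', h₂, h₂']
      · rw [hx i hik him]

/-- Every row of the desired file is requested, from `K` cyclically consecutive servers. -/
theorem exists_label_self_eq [NeZero N] (K : ℕ) (k : Fin s) (y : Fin s → Fin N) (c : Fin N) :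
    ∃ A z, IsSlot K A z ∧ ∃ hk : k ∈ A, label k (y k + c) c A z k hk = y := by
  -- The label dictates the slot: its large letters mark the other files, and server `y k + c` is
  -- the one with `n - c = y k`.
  let A : Finset (Fin s) := insert k (Finset.univ.filter fun i => K ≤ (y i : ℕ))
  have hk : k ∈ A := Finset.mem_insert_self _ _
  refine ⟨A, relead k A (Finset.nonempty_of_mem hk) (Function.update y k 0), isSlot_relead hk _ (by simp) ?_, hk, ?_⟩
  · intro i hi
    simp [A, hi]
  · rw [label_self, relead_relead]
    simp

/-- The side information in a sum is decoded from a group of `K` cyclically consecutive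
servers. -/
theorem IsSlot.exists_label_eq_of_lt [NeZero N] {k : Fin s} (n c : Fin N)
    {A : Finset (Fin s)} {z : Fin s → Fin N} (h : IsSlot K A z) (hA : A.Nonempty)
    (hB : (A.erase k).Nonempty) {d : Fin N} (hd : (d : ℕ) < K) :
    ∃ z', IsSlot K (A.erase k) z' ∧ ∀ j (hj : j ∈ A.erase k),
      label k (groupStart k n A (A.erase k) hB (relead k A hA z) + d) c (A.erase k) z' j hj =
        label k n c A z j (Finset.mem_of_mem_erase hj) := by
  have hm : (A.erase k).min' hB ≠ k := Finset.ne_of_mem_erase (Finset.min'_mem _ hB)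
  set x := relead k A hA z with hx
  -- The letter `d < K` at `k` excludes `k` from the set and is the offset of the server in its
  -- group. Labels overwrite both changed entries, so the rows stay the same.
  refine ⟨Function.update (Function.update x ((A.erase k).min' hB) 0) k d, ?_, ?_⟩
  · refine ⟨hB, by simp [hm], fun i hi => ?_⟩
    by_cases hik : i = k
    · simp [hik, hd]
    · rw [Function.update_of_ne hik, Function.update_of_ne hi, Finset.mem_erase,
        and_iff_right hik]
      exact h.mem_iff_relead_of_ne _ hB hik hi
  · intro j hj
    have hjk := Finset.ne_of_mem_erase hj
    have hkB : k ∉ A.erase k := Finset.notMem_erase _ _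
    rw [label_of_ne _ _ _ hj hjk (Finset.erase_eq_of_notMem hkB) hB,
      label_of_ne _ _ _ (Finset.mem_of_mem_erase hj) hjk rfl hB, relead_of_notMem hkB]
    congr 1
    rw [groupStart, if_neg hkB, Function.update_self, add_sub_cancel_right]
    ext i
    by_cases hik : i = k
    · simp [hik]
    by_cases him : i = (A.erase k).min' hB
    · simp [him, hm, hx]
    · simp [hik, him, hx]

/-- Every row of an undesired file that is requested at all is requested from every server. -/
theorem IsSlot.exists_label_eq [NeZero N] {k : Fin s} (n n' c : Fin N) {A : Finset (Fin s)}
    {z : Fin s → Fin N} (h : IsSlot K A z) {j : Fin s} (hj : j ∈ A) (hjk : j ≠ k) :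
    ∃ A' z', IsSlot K A' z' ∧ ∃ hj' : j ∈ A',
      label k n' c A' z' j hj' = label k n c A z j hj := by
  have hjB : j ∈ A.erase k := Finset.mem_erase.2 ⟨hjk, hj⟩
  have hB : (A.erase k).Nonempty := ⟨j, hjB⟩
  have hA : A.Nonempty := ⟨j, hj⟩
  have hmem := Finset.min'_mem _ hB
  have hm : (A.erase k).min' hB ≠ k := Finset.ne_of_mem_erase hmem
  set x := relead k A hA z with hx
  set b := groupStart k n A (A.erase k) hB x with hb
  -- The offset of `n'` from the group start decides its role: below `K` it returns the plain sum,
  -- otherwise it adds the sum to a desired symbol, and the offset becomes the letter at `min (A \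
  -- {k})`.
  by_cases hd : ((n' - b : Fin N) : ℕ) < K
  · obtain ⟨z', hz', hl⟩ := h.exists_label_eq_of_lt n c hA hB hd
    refine ⟨_, z', hz', hjB, ?_⟩
    rw [← hl j hjB, add_sub_cancel]
  · have hA' : (insert k (A.erase k)).Nonempty := Finset.insert_nonempty _ _
    have hk : k ∈ insert k (A.erase k) := Finset.mem_insert_self _ _
    let x' := Function.update (Function.update x ((A.erase k).min' hB) (n' - b)) k 0
    refine ⟨insert k (A.erase k), relead k _ hA' x', isSlot_relead hk _ (by simp [x']) ?_,
      Finset.mem_insert_of_mem hjB, ?_⟩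
    · intro i hik
      rw [Finset.mem_insert, or_iff_right hik, Finset.mem_erase, and_iff_right hik]
      by_cases him : i = (A.erase k).min' hB
      · simp only [x']
        rw [him, Function.update_of_ne hm, Function.update_self]
        exact iff_of_true (Finset.mem_of_mem_erase hmem) (not_lt.1 hd)
      · simp only [x']
        rw [Function.update_of_ne hik, Function.update_of_ne him]
        exact h.mem_iff_relead_of_ne _ hB hik him
    · rw [label_of_ne _ _ _ (Finset.mem_insert_of_mem hjB) hjk
          (Finset.erase_insert (Finset.notMem_erase _ _)) hB,
        label_of_ne _ _ _ hj hjk rfl hB, relead_relead]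
      congr 1
      rw [groupStart, if_pos hk]
      ext i
      by_cases hik : i = k
      · simp [hik]
      by_cases him : i = (A.erase k).min' hB
      · simp [him, hm, x', b, x]
      · simp [hik, him, x', x]

end BU

/-- The symbols of a codeword of an MDS code on `K` servers determine the message. -/
theorem IsMDS.eq_zero {F : Type*} [Field F] {K N : ℕ} {G : Matrix (Fin K) (Fin N) F}
    (hG : IsMDS G) (e : Fin K ↪ Fin N) {v : Fin K → F}
    (h : ∀ i, v ⬝ᵥ G.col (e i) = 0) : v = 0 := by
  have hspan := (hG e).span_eq_top_of_card_eq_finrank' (by simp)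
  have hzero : dotProductBilin F F v = 0 := by
    refine LinearMap.ext_on_range hspan fun i => ?_
    simpa using h i
  exact dotProduct_eq_zero v fun w => by simpa using congrArg (· w) hzero

theorem PMF.uniformOfFintype_map_equiv {α β : Type*} [Fintype α] [Fintype β] [Nonempty α]
    [Nonempty β] (e : α ≃ β) :
    (PMF.uniformOfFintype α).map e = PMF.uniformOfFintype β := by
  ext b
  rw [PMF.map_apply, tsum_eq_single (e.symm b)]
  · simp [Fintype.card_congr e]
  · intro a ha
    rw [if_neg]
    rintro rfl
    simp at ha

/-! ### Decoding, privacy and size of the scheme on `s` files -/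

namespace BU

variable {N K s : ℕ}

/-- The sums that the servers return determine the coefficients of the desired file. -/
theorem eq_zero_of_sums_eq_zero {F : Type*} [Field F] [NeZero N] (hKN : K ≤ N)
    {G : Matrix (Fin K) (Fin N) F} (hG : IsMDS G) (k : Fin s)
    (V : Fin s → (Fin s → Fin N) → Fin K → F)
    (h : ∀ n c : Fin N, (c : ℕ) < K → ∀ A z, IsSlot K A z →
      ∑ j, (if hj : j ∈ A then V j (label k n c A z j hj) ⬝ᵥ G.col n else 0) = 0)
    (y : Fin s → Fin N) : V k y = 0 := by
  let shift (b : Fin N) : Fin K ↪ Fin N :=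
    ⟨fun d => b + Fin.castLE hKN d, fun d d' hd =>
      Fin.castLE_injective hKN (add_left_cancel hd)⟩
  -- The row labelled `y` is requested in repetition `d` from server `y k + d`; these `K` distinct
  -- servers determine it.
  refine hG.eq_zero (shift (y k)) fun d => ?_
  set c := Fin.castLE hKN d
  have hc : (c : ℕ) < K := d.2
  obtain ⟨A, z, hs, hk, hy⟩ := exists_label_self_eq K k y c
  set n := y k + c
  -- The side information vanishes as a row vector, being seen by the `K` servers of its group;
  -- hence so does its symbol at server `n`.
  have hside : ∑ j, (if hj : j ∈ A.erase k then
      V j (label k n c A z j (Finset.mem_of_mem_erase hj)) else 0) = 0 := by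
    by_cases hB : (A.erase k).Nonempty
    · refine hG.eq_zero
        (shift (groupStart k n A (A.erase k) hB (relead k A ⟨k, hk⟩ z))) fun d => ?_
      obtain ⟨z', hs', hl⟩ := hs.exists_label_eq_of_lt n c ⟨k, hk⟩ hB
        (d := Fin.castLE hKN d) d.2
      rw [sum_dotProduct, ← h _ c hc _ _ hs']
      refine Finset.sum_congr rfl fun j _ => ?_
      by_cases hj : j ∈ A.erase k
      · rw [dif_pos hj, dif_pos hj, hl j hj]
        rfl
      · rw [dif_neg hj, dif_neg hj, zero_dotProduct]
    · exact Finset.sum_eq_zero fun j _ => dif_neg fun hj => hB ⟨j, hj⟩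
  have hsum := h n c hc A z hs
  rw [← Finset.add_sum_erase _ _ (Finset.mem_univ k), dif_pos hk, hy] at hsum
  have hside' := congrArg (· ⬝ᵥ G.col n) hside
  simp only [sum_dotProduct, zero_dotProduct] at hside'
  rw [← Finset.add_sum_erase _ _ (Finset.mem_univ k),
    dif_neg (Finset.notMem_erase k A), zero_dotProduct, zero_add] at hside'
  have hundesired : ∑ j ∈ Finset.univ.erase k,
      (if hj : j ∈ A then V j (label k n c A z j hj) ⬝ᵥ G.col n else 0) = 0 := by
    refine (Finset.sum_congr rfl fun j hj => ?_).trans hside'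
    have hjk := Finset.ne_of_mem_erase hj
    by_cases hjA : j ∈ A
    · rw [dif_pos hjA, dif_pos (Finset.mem_erase.2 ⟨hjk, hjA⟩)]
    · rw [dif_neg hjA, dif_neg (fun h => hjA (Finset.mem_of_mem_erase h)), zero_dotProduct]
  rwa [hundesired, add_zero] at hsum

/-- A single server learns nothing about which file is desired. -/
theorem queryLaw_map_apply_eq [NeZero N] (l : Fin N) (k k' : Fin s) :
    (queryLaw N K s k).map (fun q => q l) = (queryLaw N K s k').map (fun q => q l) := by
  -- The slots do not depend on the desired file, and for `k` as for `k'` the labels of file `j` at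
  -- `l` are distinct. So a permutation of all labels carries one family to the other; it is
  -- absorbed by the uniform bijection `π j`.
  have hg (j : Fin s) : ∃ g : Equiv.Perm (Fin s → Fin N),
      ∀ τ : {τ : Pos N K s // j ∈ τ.2.1.1},
        g (label k l τ.1.1.1 τ.1.2.1.1 τ.1.2.1.2 j τ.2) =
          label k' l τ.1.1.1 τ.1.2.1.1 τ.1.2.1.2 j τ.2 := by
    have hinj (k : Fin s) : Function.Injective fun τ : {τ : Pos N K s // j ∈ τ.2.1.1} =>
        label k l τ.1.1.1 τ.1.2.1.1 τ.1.2.1.2 j τ.2 := by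
      rintro ⟨⟨⟨c, hc⟩, ⟨⟨A, z⟩, h⟩⟩, hj⟩ ⟨⟨⟨c', hc'⟩, ⟨⟨A', z'⟩, h'⟩⟩, hj'⟩ he
      obtain ⟨rfl, rfl, rfl⟩ := label_injective (K := K) h h' hj hj' he
      rfl
    exact Equiv.Perm.exists_extending_pair _ _ (hinj k) (hinj k')
  choose g hg using hg
  have : Nonempty (Fin s → ((Fin s → Fin N) ≃ Fin (N ^ s))) := ⟨fun _ => finFunctionFinEquiv⟩
  let Φ : (Fin s → ((Fin s → Fin N) ≃ Fin (N ^ s))) ≃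
      (Fin s → ((Fin s → Fin N) ≃ Fin (N ^ s))) :=
    Equiv.piCongrRight fun j => Equiv.equivCongr (g j).symm (Equiv.refl _)
  simp only [queryLaw, PMF.map_bind, PMF.map_comp]
  rw [← PMF.uniformOfFintype_map_equiv Φ, PMF.bind_map, PMF.uniformOfFintype_map_equiv Φ]
  congr 1
  funext π
  rw [Function.comp_apply]
  congr 1
  funext σ τ j
  simp only [Function.comp_apply]
  split_ifs with hj
  · rw [← hg j ⟨σ l τ, hj⟩]
    simp [Φ]
  · rfl

/-- Slots are sorted by `i = min A`. The word then determines `A`: letters before `i` are `< K`, the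
letter at `i` is `0`, and letters after `i` are arbitrary. -/
theorem card_slot [NeZero N] (hKN : K ≤ N) :
    Fintype.card (Slot N K s) = ∑ i : Fin s, K ^ (i : ℕ) * N ^ (s - 1 - i) := by
  let T (i j : Fin s) : Finset (Fin N) :=
    if j < i then Finset.univ.filter fun a => (a : ℕ) < K
    else if j = i then {0} else Finset.univ
  have hcard : Fintype.card (Slot N K s) =
      (Finset.univ.sigma fun i => Fintype.piFinset (T i)).card := by
    rw [← Finset.card_univ]
    refine Finset.card_bij
      (fun a _ => ⟨a.1.1.min' a.2.choose, a.1.2⟩) ?_ ?_ ?_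
    · rintro ⟨⟨A, z⟩, h⟩ -
      obtain ⟨h₂, h₃⟩ := h.choose_spec
      simp only [Finset.mem_sigma, Finset.mem_univ, true_and, Fintype.mem_piFinset]
      intro j
      simp only [T]
      split_ifs with hlt heq
      · have : j ∉ A := fun hj => not_le.2 hlt (Finset.min'_le _ _ hj)
        simpa using mt (h₃ j hlt.ne).2 this
      · rw [heq, Finset.mem_singleton]
        exact Fin.ext h₂
      · simp
    · rintro ⟨⟨A, z⟩, h⟩ - ⟨⟨A', z'⟩, h'⟩ - he
      obtain ⟨-, h₃⟩ := h.choose_spec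
      obtain ⟨-, h₃'⟩ := h'.choose_spec
      simp only [Sigma.mk.injEq, heq_eq_eq] at he
      obtain ⟨hm, rfl⟩ := he
      have : A = A' := by
        ext i
        by_cases hi : i = A.min' h.choose
        · refine iff_of_true (hi ▸ Finset.min'_mem _ _) ?_
          rw [hi.trans hm]
          exact Finset.min'_mem _ _
        · rw [h₃ i hi, h₃' i (hm ▸ hi)]
      subst this
      rfl
    · rintro ⟨i, z⟩ hz
      simp only [Finset.mem_sigma, Finset.mem_univ, true_and, Fintype.mem_piFinset] at hz
      have hzi : z i = 0 := by simpa [T] using hz i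
      let A : Finset (Fin s) := insert i (Finset.univ.filter fun j => i < j ∧ K ≤ (z j : ℕ))
      have hA : A.Nonempty := Finset.insert_nonempty _ _
      have hmin : A.min' hA = i := by
        refine le_antisymm (Finset.min'_le _ _ (Finset.mem_insert_self _ _)) ?_
        refine Finset.le_min' _ _ _ fun j hj => ?_
        rcases Finset.mem_insert.1 hj with rfl | hj
        · exact le_rfl
        · exact (Finset.mem_filter.1 hj).2.1.le
      refine ⟨⟨(A, z), hA, by simp [hmin, hzi], fun j hj => ?_⟩, Finset.mem_univ _, ?_⟩
      · simp only [hmin] at hj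
        rcases lt_or_gt_of_ne hj with hlt | hgt
        · have : (z j : ℕ) < K := by simpa [T, hlt] using hz j
          simp [A, hj, hlt.not_gt, this]
        · simp [A, hj, hgt]
      · simp [hmin]
  rw [hcard, Finset.card_sigma]
  refine Finset.sum_congr rfl fun i _ => ?_
  rw [Fintype.card_piFinset]
  have hT (j : Fin s) : (T i j).card = (if j < i then K else 1) * (if i < j then N else 1) := by
    simp only [T]
    rcases lt_trichotomy j i with h | h | h
    · simp [h, h.not_gt, Fin.card_filter_val_lt, hKN]
    · simp [h]
    · simp [h, h.not_gt, h.ne']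
  simp only [hT, Finset.prod_mul_distrib, Finset.prod_ite, Finset.prod_const]
  simp [Finset.filter_gt_eq_Iio, Finset.filter_lt_eq_Ioi]

end BU

/-- The two-point law of `M'`; leakage and rate use it only through this formula. -/
theorem FinProb.exists_pmf_expect_eq {α : Type*} [Fintype α] (a b : α) {p : ℝ} (h0 : 0 ≤ p)
    (h1 : p ≤ 1) :
    ∃ P : PMF α, ∀ f : α → ℝ, FinProb.expect P f = p * f a + (1 - p) * f b := by
  let B : PMF Bool := PMF.ofFintype
    (fun x => if x then ENNReal.ofReal p else ENNReal.ofReal (1 - p))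
    (by simp [← ENNReal.ofReal_add h0 (sub_nonneg.2 h1)])
  refine ⟨B.map fun x => if x then a else b, fun f => ?_⟩
  rw [FinProb.expect_map]
  simp [FinProb.expect, B, ENNReal.toReal_ofReal, h0, h1]

/-! ### Leakage and rate of a general scheme -/

namespace IRScheme

variable {M N L : ℕ} {F : Type u} [NeZero M]

theorem expect_indexQueryLaw (C : IRScheme M N L F) (f : Fin M × (Fin N → C.Query) → ℝ) :
    FinProb.expect C.indexQueryLaw f =
      (1 / (M : ℝ)) * ∑ θ, FinProb.expect (C.queryLaw θ) (fun q => f (θ, q)) := by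
  rw [indexQueryLaw, FinProb.expect_bind, FinProb.expect_uniform, Fintype.card_fin]
  simp only [FinProb.expect_map]

theorem prob_index_query (C : IRScheme M N L F) (l : Fin N) (x : Fin M) (y : C.Query) :
    FinProb.prob C.indexQueryLaw (fun ω => (ω.1, ω.2 l)) (x, y) =
      (1 / (M : ℝ)) * FinProb.prob (C.queryLaw x) (fun q => q l) y := by
  rw [FinProb.prob_eq_expect, expect_indexQueryLaw, Finset.sum_eq_single x]
  · simp [FinProb.prob_eq_expect]
  · intro θ _ hθ
    simp [hθ, FinProb.expect_const]
  · simp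

theorem prob_index (C : IRScheme M N L F) (x : Fin M) :
    FinProb.prob C.indexQueryLaw (fun ω => ω.1) x = 1 / M := by
  rw [FinProb.prob_eq_expect, expect_indexQueryLaw, Finset.sum_eq_single x]
  · simp [FinProb.expect_const]
  · intro θ _ hθ
    simp [hθ, FinProb.expect_const]
  · simp

/-- If every server receives either a query that reveals the desired file or one that is
independent of it, then the leakage is governed by the expected number of revealing queries. -/
theorem mil_eq_of_reveal (C : IRScheme M N L F) (R : C.Query → Prop) {c : ℝ}
    (hR : ∀ l y, R y → ∃ k, ∀ x, x ≠ k → FinProb.prob (C.queryLaw x) (fun q => q l) y = 0)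
    (hnR : ∀ l y, ¬ R y → ∀ x x', FinProb.prob (C.queryLaw x) (fun q => q l) y =
      FinProb.prob (C.queryLaw x') (fun q => q l) y)
    (hc : ∀ θ, FinProb.expect (C.queryLaw θ) (fun q => ∑ l, if R (q l) then 1 else 0) = c) :
    C.mil = c * Real.logb 2 M / N := by
  have hM : (M : ℝ) ≠ 0 := NeZero.ne _
  have hI (l : Fin N) := FinProb.mutualInfo_of_reveal (p := C.indexQueryLaw)
    (X := fun ω => ω.1) (Y := fun ω => ω.2 l)
    (fun x => by rw [prob_index, Fintype.card_fin]) R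
    (fun y hy => by
      obtain ⟨k, hk⟩ := hR l y hy
      exact ⟨k, fun x hx => by rw [prob_index_query, hk x hx, mul_zero]⟩)
    (fun y hy x x' => by rw [prob_index_query, prob_index_query, hnR l y hy x x'])
  simp only [mil, hI, Fintype.card_fin]
  rw [← Finset.mul_sum, ← FinProb.expect_sum, expect_indexQueryLaw]
  simp only [hc, Finset.sum_const, Finset.card_univ, Fintype.card_fin, nsmul_eq_mul]
  field_simp

variable [Field F] [Fintype F]

theorem expect_law_eq (C : IRScheme M N L F) {K : ℕ}
    {f : Fin M × (Fin M → Matrix (Fin L) (Fin K) F) × (Fin N → C.Query) → ℝ} {d : ℝ}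
    (h : ∀ θ W, FinProb.expect (C.queryLaw θ) (fun q => f (θ, W, q)) = d) :
    FinProb.expect (C.law K) f = d := by
  simp only [law, FinProb.expect_bind, FinProb.expect_map, h, FinProb.expect_const]

theorem rate_eq_div (C : IRScheme M N L F) {K : ℕ} (G : Matrix (Fin K) (Fin N) F) {d : ℝ}
    (hd : ∀ θ W, FinProb.expect (C.queryLaw θ)
      (fun q => ∑ l, ((C.answers G W q l).length : ℝ)) = d) :
    C.rate G = (L * K : ℕ) / d := by
  have hlog : Real.logb 2 (Fintype.card F) ≠ 0 :=
    (Real.logb_pos one_lt_two (by exact_mod_cast Fintype.one_lt_card)).ne'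
  rw [rate, C.expect_law_eq (d := d * Real.logb 2 (Fintype.card F)), mul_div_mul_right _ _ hlog]
  intro θ W
  simp only [← Finset.sum_mul]
  rw [FinProb.expect_mul_const, hd]

theorem mem_support_queryLaw {C : IRScheme M N L F} {K : ℕ}
    {ω : Fin M × (Fin M → Matrix (Fin L) (Fin K) F) × (Fin N → C.Query)}
    (h : ω ∈ (C.law K).support) : ω.2.2 ∈ (C.queryLaw ω.1).support := by
  simp only [law, PMF.mem_support_bind_iff, PMF.mem_support_map_iff] at h
  obtain ⟨θ, -, W, -, q, hq, rfl⟩ := h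
  exact hq

end IRScheme

/-! ### Decodability of the weakly private scheme -/

namespace WBU

variable {M N K : ℕ}

/-- The law of the queries, given the desired file `k` and the number `m'` of additional files. -/
def queryLawGiven (hKN : K ≤ N) (k m' : Fin M) : PMF (Fin N → Query M N K) :=
  if (m' : ℕ) = 0 then
    haveI := subsets_nonempty hKN
    (PMF.uniformOfFintype {S : Finset (Fin N) // S.card = K}).map fun S l =>
      if l ∈ S.1 then Query.clean k else Query.null
  else
    haveI := others_nonempty k m'
    (PMF.uniformOfFintype (Others k m')).bind fun J =>
      (BU.queryLaw N K ((m' : ℕ) + 1)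
          ((numbering J).symm ⟨k, Finset.mem_insert_self k J.1⟩)).map fun q l =>
        Query.sums m' fun τ i =>
          if hi : i ∈ insert k J.1 then q l τ ((numbering J).symm ⟨i, hi⟩) else none

theorem queryLaw_eq_bind (hKN : K ≤ N) (P : PMF (Fin M)) (k : Fin M) :
    queryLaw hKN P k = P.bind (queryLawGiven hKN k) := rfl

/-- The number of the desired file. -/
def desired {k m' : Fin M} (J : Others k m') : Fin ((m' : ℕ) + 1) :=
  (numbering J).symm ⟨k, Finset.mem_insert_self k J.1⟩

/-- The requests to the servers for fixed private labels `π` and orders `σ`. -/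
def request {k m' : Fin M} (J : Others k m')
    (π : Fin ((m' : ℕ) + 1) → ((Fin ((m' : ℕ) + 1) → Fin N) ≃ Fin (N ^ ((m' : ℕ) + 1))))
    (σ : Fin N → Equiv.Perm (BU.Pos N K ((m' : ℕ) + 1))) (l : Fin N)
    (τ : BU.Pos N K ((m' : ℕ) + 1)) (i : Fin M) : Option (Fin (N ^ ((m' : ℕ) + 1))) :=
  if hi : i ∈ insert k J.1 then
    if hj : (numbering J).symm ⟨i, hi⟩ ∈ (σ l τ).2.1.1 then
      some (π ((numbering J).symm ⟨i, hi⟩)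
        (BU.label (desired J) l (σ l τ).1.1 (σ l τ).2.1.1 (σ l τ).2.1.2 _ hj))
    else none
  else none

theorem mem_support_queryLawGiven {hKN : K ≤ N} {k m' : Fin M} {q : Fin N → Query M N K}
    (hq : q ∈ (queryLawGiven hKN k m').support) :
    ((m' : ℕ) = 0 ∧ ∃ S : Finset (Fin N), S.card = K ∧
      q = fun l => if l ∈ S then Query.clean k else Query.null) ∨
    (m' : ℕ) ≠ 0 ∧ ∃ (J : Others k m')
      (π : Fin ((m' : ℕ) + 1) → ((Fin ((m' : ℕ) + 1) → Fin N) ≃ Fin (N ^ ((m' : ℕ) + 1))))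
      (σ : Fin N → Equiv.Perm (BU.Pos N K ((m' : ℕ) + 1))),
      q = fun l => Query.sums m' (request J π σ l) := by
  rw [queryLawGiven] at hq
  split_ifs at hq with h0
  · left
    simp only [PMF.mem_support_map_iff] at hq
    obtain ⟨S, -, rfl⟩ := hq
    exact ⟨h0, S.1, S.2, rfl⟩
  · right
    simp only [BU.queryLaw, PMF.mem_support_bind_iff, PMF.mem_support_map_iff] at hq
    obtain ⟨J, -, _, ⟨π, -, σ, -, rfl⟩, rfl⟩ := hq
    exact ⟨h0, J, π, σ, rfl⟩

theorem exists_given_of_mem_support {hKN : K ≤ N} {P : PMF (Fin M)} {k : Fin M}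
    {q : Fin N → Query M N K} (hq : q ∈ (queryLaw hKN P k).support) :
    ∃ m', q ∈ (queryLawGiven hKN k m').support := by
  rw [queryLaw_eq_bind, PMF.mem_support_bind_iff] at hq
  obtain ⟨m', -, h⟩ := hq
  exact ⟨m', h⟩

theorem stored_apply {F : Type u} [Field F] {L : ℕ} (G : Matrix (Fin K) (Fin N) F)
    (W : Fin M → Matrix (Fin L) (Fin K) F) (l : Fin N) (m : Fin M) (r : Fin L) :
    stored G W l m r = W m r ⬝ᵥ G.col l := rfl

theorem superRow_surjective {s : ℕ} (hs : s ≤ M) (r : Fin (N ^ M)) :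
    ∃ a t, superRow (N := N) hs a t = r := by
  obtain ⟨⟨a, t⟩, h⟩ :=
    finProdFinEquiv.surjective (Fin.cast (pow_mul_pow_sub N hs).symm r)
  exact ⟨a, t, by rw [superRow, h]; simp⟩

theorem request_numbering {k m' : Fin M} (J : Others k m')
    (π : Fin ((m' : ℕ) + 1) → ((Fin ((m' : ℕ) + 1) → Fin N) ≃ Fin (N ^ ((m' : ℕ) + 1))))
    (σ : Fin N → Equiv.Perm (BU.Pos N K ((m' : ℕ) + 1))) (l : Fin N)
    (τ : BU.Pos N K ((m' : ℕ) + 1)) (j : Fin ((m' : ℕ) + 1)) :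
    request J π σ l τ (numbering J j) =
      if hj : j ∈ (σ l τ).2.1.1 then
        some (π j (BU.label (desired J) l (σ l τ).1.1 (σ l τ).2.1.1 (σ l τ).2.1.2 j hj))
      else none := by
  have key (j') (h : j' = j) : (if hj : j' ∈ (σ l τ).2.1.1 then
        some (π j' (BU.label (desired J) l (σ l τ).1.1 (σ l τ).2.1.1 (σ l τ).2.1.2 j' hj))
      else none) = if hj : j ∈ (σ l τ).2.1.1 then
        some (π j (BU.label (desired J) l (σ l τ).1.1 (σ l τ).2.1.1 (σ l τ).2.1.2 j hj))
      else none := by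
    subst h
    rfl
  rw [request, dif_pos (numbering J j).2]
  exact key _ (by simp)

theorem request_eq_some {k m' : Fin M} (J : Others k m')
    (π : Fin ((m' : ℕ) + 1) → ((Fin ((m' : ℕ) + 1) → Fin N) ≃ Fin (N ^ ((m' : ℕ) + 1))))
    (σ : Fin N → Equiv.Perm (BU.Pos N K ((m' : ℕ) + 1))) (l : Fin N) {c : Fin N}
    (hc : (c : ℕ) < K) {A : Finset (Fin ((m' : ℕ) + 1))} {z : Fin ((m' : ℕ) + 1) → Fin N}
    (hs : BU.IsSlot K A z) {j : Fin ((m' : ℕ) + 1)} (hj : j ∈ A) :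
    request J π σ l ((σ l).symm (⟨c, hc⟩, ⟨(A, z), hs⟩)) (numbering J j) =
      some (π j (BU.label (desired J) l c A z j hj)) := by
  rw [request_numbering, Equiv.apply_symm_apply]
  exact dif_pos hj

theorem numbering_desired {k m' : Fin M} (J : Others k m') :
    (numbering J (desired J) : Fin M) = k := by
  simp [desired]

/-- A sum over all files that are requested, in terms of their numbers. -/
theorem sum_request {F : Type*} [AddCommMonoid F] {k m' : Fin M} (J : Others k m')
    (π : Fin ((m' : ℕ) + 1) → ((Fin ((m' : ℕ) + 1) → Fin N) ≃ Fin (N ^ ((m' : ℕ) + 1))))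
    (σ : Fin N → Equiv.Perm (BU.Pos N K ((m' : ℕ) + 1))) (l : Fin N) {c : Fin N}
    (hc : (c : ℕ) < K) {A : Finset (Fin ((m' : ℕ) + 1))} {z : Fin ((m' : ℕ) + 1) → Fin N}
    (hs : BU.IsSlot K A z) (g : Fin M → Fin (N ^ ((m' : ℕ) + 1)) → F) :
    ∑ i, (match request J π σ l ((σ l).symm (⟨c, hc⟩, ⟨(A, z), hs⟩)) i with
        | none => 0
        | some r => g i r) =
      ∑ j, if hj : j ∈ A then
        g (numbering J j) (π j (BU.label (desired J) l c A z j hj)) else 0 := by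
  rw [← Finset.sum_subset (Finset.subset_univ (insert k J.1)), ← Finset.sum_coe_sort,
    ← (numbering J).sum_comp]
  · refine Finset.sum_congr rfl fun j _ => ?_
    by_cases hj : j ∈ A
    · rw [request_eq_some J π σ l hc hs hj, dif_pos hj]
    · rw [request_numbering, Equiv.apply_symm_apply, dif_neg hj, dif_neg hj]
  · intro i _ hi
    simp only [request, dif_neg hi]

/-- The client can decode the desired file. -/
theorem decode {F : Type u} [Field F] [NeZero N] {hKN : K ≤ N} {P : PMF (Fin M)}
    {G : Matrix (Fin K) (Fin N) F} (hG : IsMDS G) {k : Fin M} {q : Fin N → Query M N K}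
    (hq : q ∈ (queryLaw hKN P k).support) {W W' : Fin M → Matrix (Fin (N ^ M)) (Fin K) F}
    (h : ∀ l, answer (q l) (stored G W l) = answer (q l) (stored G W' l)) : W k = W' k := by
  obtain ⟨m', hq⟩ := exists_given_of_mem_support hq
  rcases mem_support_queryLawGiven hq with ⟨-, S, hS, rfl⟩ | ⟨-, J, π, σ, rfl⟩
  · refine funext fun r => ?_
    rw [← sub_eq_zero]
    -- The clean queries return `K` symbols of each row.
    refine hG.eq_zero (S.orderEmbOfFin hS).toEmbedding fun i => ?_
    have hl := h (S.orderEmbOfFin hS i)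
    simp only [Finset.orderEmbOfFin_mem, if_true, answer] at hl
    have := congrFun (List.ofFn_injective hl) r
    rw [stored_apply, stored_apply] at this
    rw [sub_dotProduct, sub_eq_zero]
    exact this
  · refine funext fun r => ?_
    obtain ⟨a, t, rfl⟩ := superRow_surjective m'.isLt r
    -- For each position `t` inside the super-rows, the differences of the two sets of files satisfy
    -- the homogeneous system.
    have key := BU.eq_zero_of_sums_eq_zero hKN hG (desired J)
      (fun j y => W (numbering J j) (superRow m'.isLt (π j y) t) -
        W' (numbering J j) (superRow m'.isLt (π j y) t)) ?_ ((π (desired J)).symm a)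
    · simpa [sub_eq_zero, desired] using key
    · intro n c hc A z hs
      have hn := h n
      simp only [answer, List.map_inj_left] at hn
      have hτ := (sum_request J π σ n hc hs
        fun i r => stored G W n i (superRow m'.isLt r t)).symm.trans
          ((hn ((σ n).symm (⟨c, hc⟩, ⟨(A, z), hs⟩), t) (by simp)).trans
            (sum_request J π σ n hc hs fun i r => stored G W' n i (superRow m'.isLt r t)))
      rw [← sub_eq_zero, ← Finset.sum_sub_distrib] at hτ
      simp only [stored_apply] at hτ
      refine (Finset.sum_congr rfl fun j _ => ?_).trans hτ
      by_cases hj : j ∈ A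
      · simp only [dif_pos hj, sub_dotProduct]
      · simp only [dif_neg hj, sub_zero]

/-- Some row of the desired file is not requested from all servers. -/
theorem exists_request_desired [NeZero N] (hK : 1 ≤ K) (hKN : K < N) {k m' : Fin M}
    (J : Others k m')
    (π : Fin ((m' : ℕ) + 1) → ((Fin ((m' : ℕ) + 1) → Fin N) ≃ Fin (N ^ ((m' : ℕ) + 1))))
    (σ : Fin N → Equiv.Perm (BU.Pos N K ((m' : ℕ) + 1))) :
    ∃ l l' r, (∃ τ, request J π σ l τ k = some r) ∧ ∀ τ, request J π σ l' τ k ≠ some r := by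
  obtain ⟨A, z, hs, hA, hy⟩ := BU.exists_label_self_eq K (desired J) (fun _ => (0 : Fin N)) 0
  have hl := request_eq_some J π σ (0 + 0) (c := 0) (by rw [Fin.val_zero]; exact hK) hs hA
  rw [numbering_desired, hy] at hl
  -- The row with the all-zero label goes to a server `n` only if `n = c` for a repetition `c < K`,
  -- so never to server `K`.
  refine ⟨_, ⟨K, hKN⟩, _, ⟨_, hl⟩, fun τ hτ => ?_⟩
  have hl' := request_numbering J π σ ⟨K, hKN⟩ τ (desired J)
  rw [numbering_desired, hτ] at hl'
  split_ifs at hl' with hj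
  have := congrFun ((π _).injective (Option.some_injective _ hl')) (desired J)
  rw [BU.label_self, Function.update_self, eq_comm, sub_eq_zero] at this
  have hc := (σ ⟨K, hKN⟩ τ).1.2
  rw [← this] at hc
  exact lt_irrefl _ hc

/-- The rows of the undesired files are requested from all servers or from none. -/
theorem exists_request_of_ne [NeZero N] {k m' : Fin M} (J : Others k m')
    (π : Fin ((m' : ℕ) + 1) → ((Fin ((m' : ℕ) + 1) → Fin N) ≃ Fin (N ^ ((m' : ℕ) + 1))))
    (σ : Fin N → Equiv.Perm (BU.Pos N K ((m' : ℕ) + 1))) {i : Fin M} (hik : i ≠ k)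
    {l : Fin N} (l' : Fin N) {r : Fin (N ^ ((m' : ℕ) + 1))}
    (h : ∃ τ, request J π σ l τ i = some r) : ∃ τ, request J π σ l' τ i = some r := by
  obtain ⟨τ, hτ⟩ := h
  have hi : i ∈ insert k J.1 := by
    by_contra hi
    rw [request, dif_neg hi] at hτ
    cases hτ
  obtain ⟨j, hj⟩ := (numbering J).surjective ⟨i, hi⟩
  obtain rfl : (numbering J j : Fin M) = i := congrArg Subtype.val hj
  rw [request_numbering] at hτ
  split_ifs at hτ with hjA
  have hne : j ≠ desired J := fun h => hik (h ▸ numbering_desired J)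
  obtain ⟨A, z, hs, hA, hl⟩ :=
    BU.IsSlot.exists_label_eq l l' (σ l τ).1.1 (σ l τ).2.2 hjA hne
  refine ⟨_, (request_eq_some J π σ l' (σ l τ).1.2 hs hA).trans ?_⟩
  rw [hl, hτ]

/-- If `K < N`, then the queries determine the desired file. -/
theorem index_unique [NeZero N] (hK : 1 ≤ K) (hlt : K < N) {hKN : K ≤ N} {P : PMF (Fin M)}
    {k k' : Fin M} {q : Fin N → Query M N K} (hq : q ∈ (queryLaw hKN P k).support)
    (hq' : q ∈ (queryLaw hKN P k').support) : k = k' := by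
  obtain ⟨m, hq⟩ := exists_given_of_mem_support hq
  obtain ⟨m', hq'⟩ := exists_given_of_mem_support hq'
  rcases mem_support_queryLawGiven hq with ⟨-, S, hS, rfl⟩ | ⟨-, J, π, σ, rfl⟩ <;>
    rcases mem_support_queryLawGiven hq' with ⟨-, S', hS', h⟩ | ⟨-, J', π', σ', h⟩
  · obtain ⟨l, hl⟩ := Finset.card_pos.1 (hS.symm ▸ hK : 0 < S.card)
    have := congrFun h l
    rw [if_pos hl] at this
    split_ifs at this
    injection this
  · have := congrFun h 0
    split_ifs at this
  · have := congrFun h 0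
    split_ifs at this
  · have hm : m = m' := by
      have := congrFun h 0
      injection this
    subst hm
    have hr (l : Fin N) : request J π σ l = request J' π' σ' l := by
      have := congrFun h l
      injection this
    -- With desired file `k`, some row of file `k` is requested from `l` but not from `l'`; with
    -- desired file `k' ≠ k`, file `k` is undesired and this cannot happen.
    by_contra hne
    obtain ⟨l, l', r, h₁, h₂⟩ := exists_request_desired hK hlt J π σ
    simp only [hr] at h₁ h₂
    obtain ⟨τ, hτ⟩ := exists_request_of_ne J' π' σ' hne l' h₁
    exact h₂ τ hτ

end WBU

/-! ### Leakage and rate of the weakly private scheme -/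

namespace WBU

variable {M N K : ℕ}

theorem insert_eq_univ {k m' : Fin M} (hm : (m' : ℕ) + 1 = M) (J : Others k m') :
    insert k J.1 = Finset.univ := by
  rw [← Finset.card_eq_iff_eq_univ, Finset.card_insert_of_notMem J.2.1, J.2.2, hm,
    Fintype.card_fin]

/-- The increasing enumeration of all files is unique, so the choice of `J` leaves no trace in the
query. -/
theorem numbering_symm_of_full {k m' : Fin M} (hm : (m' : ℕ) + 1 = M) (J : Others k m')
    {i : Fin M} (hi : i ∈ insert k J.1) :
    (numbering J).symm ⟨i, hi⟩ = Fin.cast hm.symm i := by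
  have hcard : (insert k J.1).card = (m' : ℕ) + 1 := by
    rw [Finset.card_insert_of_notMem J.2.1, J.2.2]
  have h := Finset.orderEmbOfFin_unique hcard (f := Fin.cast hm)
    (fun x => insert_eq_univ hm J ▸ Finset.mem_univ _) (Fin.cast_strictMono hm)
  rw [Equiv.symm_apply_eq]
  ext1
  change i = (insert k J.1).orderEmbOfFin hcard (Fin.cast hm.symm i)
  rw [← h, Fin.cast_cast, Fin.cast_eq_self]

/-- If all files are involved, then a single server learns nothing about the desired file. -/
theorem queryLawGiven_map_apply_eq [NeZero N] (hKN : K ≤ N) {m' : Fin M}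
    (hm : (m' : ℕ) + 1 = M) (h0 : (m' : ℕ) ≠ 0) (l : Fin N) (k k' : Fin M) :
    (queryLawGiven hKN k m').map (fun q => q l) =
      (queryLawGiven hKN k' m').map (fun q => q l) := by
  have key (k : Fin M) : (queryLawGiven hKN k m').map (fun q => q l) =
      ((BU.queryLaw N K ((m' : ℕ) + 1) (Fin.cast hm.symm k)).map fun q => q l).map
        fun r => Query.sums m' fun τ i => r τ (Fin.cast hm.symm i) := by
    rw [queryLawGiven, if_neg h0, PMF.map_bind]
    refine Eq.trans ?_ (PMF.bind_const (@PMF.uniformOfFintype _ _ (others_nonempty k m')) _)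
    congr 1
    funext J
    rw [numbering_symm_of_full hm, PMF.map_comp, PMF.map_comp]
    congr 1
    funext q
    simp only [Function.comp_apply]
    congr 1
    funext τ i
    have hi : i ∈ insert k J.1 := insert_eq_univ hm J ▸ Finset.mem_univ _
    rw [dif_pos hi, numbering_symm_of_full hm]
  rw [key, key, BU.queryLaw_map_apply_eq l (Fin.cast hm.symm k) (Fin.cast hm.symm k')]

/-- The query asks for everything that is stored of some file. -/
def Query.IsClean (y : Query M N K) : Prop := ∃ k, y = Query.clean k

theorem prob_clean_eq_zero {hKN : K ≤ N} {P : PMF (Fin M)} {k x : Fin M} (hx : x ≠ k)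
    (l : Fin N) :
    FinProb.prob (queryLaw hKN P x) (fun q => q l) (Query.clean k) = 0 := by
  refine FinProb.prob_eq_zero fun q hq he => ?_
  obtain ⟨m', hq⟩ := exists_given_of_mem_support hq
  rcases mem_support_queryLawGiven hq with ⟨-, S, hS, rfl⟩ | ⟨-, J, π, σ, rfl⟩
  · dsimp only at he
    split_ifs at he
    injection he with he
    exact hx he
  · cases he

/-- The two atoms are treated separately: for `M' = 0` only the null query is not clean, and the law
of `S` ignores the desired file; for `M' = M - 1` single-server privacy applies. -/
theorem prob_not_clean_eq [NeZero M] [NeZero N] {hKN : K ≤ N} {P : PMF (Fin M)} {p : ℝ}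
    {m' : Fin M} (hm : (m' : ℕ) + 1 = M) (h0 : (m' : ℕ) ≠ 0)
    (hP : ∀ f, FinProb.expect P f = p * f 0 + (1 - p) * f m') (l : Fin N)
    {y : Query M N K} (hy : ¬ y.IsClean) (x x' : Fin M) :
    FinProb.prob (queryLaw hKN P x) (fun q => q l) y =
      FinProb.prob (queryLaw hKN P x') (fun q => q l) y := by
  simp only [FinProb.prob_eq_expect, queryLaw_eq_bind, FinProb.expect_bind, hP]
  congr 2
  · rw [queryLawGiven, queryLawGiven, if_pos (Fin.val_zero M), if_pos (Fin.val_zero M),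
      FinProb.expect_map, FinProb.expect_map]
    congr 1
    funext S
    refine if_congr ?_ rfl rfl
    dsimp only
    split_ifs
    · exact iff_of_false (fun h => hy ⟨x, h.symm⟩) (fun h => hy ⟨x', h.symm⟩)
    · rfl
  · rw [← FinProb.expect_map (queryLawGiven hKN x m') (fun q => q l)
        (fun r => if r = y then 1 else 0),
      ← FinProb.expect_map (queryLawGiven hKN x' m') (fun q => q l)
        (fun r => if r = y then 1 else 0), queryLawGiven_map_apply_eq hKN hm h0 l x x']

theorem expect_card_clean {hKN : K ≤ N} (k m' : Fin M) :
    FinProb.expect (queryLawGiven hKN k m')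
        (fun q => ∑ l, if (q l).IsClean then (1 : ℝ) else 0) =
      if (m' : ℕ) = 0 then (K : ℝ) else 0 := by
  refine (FinProb.expect_congr fun q hq => ?_).trans (FinProb.expect_const _ _)
  rcases mem_support_queryLawGiven hq with ⟨h0, S, rfl, rfl⟩ | ⟨h0, J, π, σ, rfl⟩
  · rw [if_pos h0, Finset.sum_congr rfl (g := fun l => if l ∈ S then (1 : ℝ) else 0)]
    · simp
    · intro l _
      by_cases hl : l ∈ S <;> simp [hl, Query.IsClean]
  · simp [h0, Query.IsClean]

theorem expect_queryLaw [NeZero M] {hKN : K ≤ N} {P : PMF (Fin M)} {p : ℝ} {m' : Fin M}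
    (hP : ∀ f, FinProb.expect P f = p * f 0 + (1 - p) * f m') (k : Fin M)
    {f : (Fin N → Query M N K) → ℝ} {v : Fin M → ℝ}
    (hv : ∀ m, FinProb.expect (queryLawGiven hKN k m) f = v m) :
    FinProb.expect (queryLaw hKN P k) f = p * v 0 + (1 - p) * v m' := by
  simp only [queryLaw_eq_bind, FinProb.expect_bind, hP, hv]

theorem mil_eq {F : Type u} [Field F] [NeZero M] [NeZero N] {hKN : K ≤ N} {P : PMF (Fin M)}
    {p : ℝ} {m' : Fin M} (hm : (m' : ℕ) + 1 = M) (h0 : (m' : ℕ) ≠ 0)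
    (hP : ∀ f, FinProb.expect P f = p * f 0 + (1 - p) * f m') :
    (scheme M N K F hKN P).mil = p * K * Real.logb 2 M / N := by
  refine IRScheme.mil_eq_of_reveal _ (Query.IsClean (N := N) (K := K)) ?_ ?_ ?_
  · rintro l _ ⟨k, rfl⟩
    exact ⟨k, fun x hx => prob_clean_eq_zero (hKN := hKN) hx l⟩
  · exact fun l y hy x x' => prob_not_clean_eq (hKN := hKN) hm h0 hP l hy x x'
  · intro θ
    refine (expect_queryLaw hP θ (expect_card_clean (hKN := hKN) θ)).trans ?_
    simp [h0]

theorem card_pos (s : ℕ) [NeZero N] (hKN : K ≤ N) :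
    Fintype.card (BU.Pos N K s) = K * ∑ i : Fin s, K ^ (i : ℕ) * N ^ (s - 1 - i) := by
  rw [Fintype.card_prod, BU.card_slot hKN]
  congr 1
  rw [Fintype.card_subtype, Fin.card_filter_val_lt, min_eq_right hKN]

theorem expect_length_answer {F : Type u} [Field F] {hKN : K ≤ N} (k : Fin M)
    (X : Fin N → Fin M → Fin (N ^ M) → F) (m' : Fin M) :
    FinProb.expect (queryLawGiven hKN k m')
        (fun q => ∑ l, ((answer (q l) (X l)).length : ℝ)) =
      if (m' : ℕ) = 0 then (K : ℝ) * N ^ M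
      else N * (Fintype.card (BU.Pos N K ((m' : ℕ) + 1)) * N ^ (M - ((m' : ℕ) + 1))) := by
  refine (FinProb.expect_congr fun q hq => ?_).trans (FinProb.expect_const _ _)
  rcases mem_support_queryLawGiven hq with ⟨h0, S, rfl, rfl⟩ | ⟨h0, J, π, σ, rfl⟩
  · rw [if_pos h0,
      Finset.sum_congr rfl (g := fun l => if l ∈ S then (N : ℝ) ^ M else 0)]
    · simp
    · intro l _
      by_cases hl : l ∈ S <;> simp [hl, answer]
  · simp [h0, answer]

theorem rate_eq {F : Type u} [Field F] [Fintype F] [NeZero M] [NeZero N] {hKN : K ≤ N}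
    {P : PMF (Fin M)} {p : ℝ} {m' : Fin M} (hK : 1 ≤ K) (hm : (m' : ℕ) + 1 = M)
    (h0 : (m' : ℕ) ≠ 0)
    (hP : ∀ f, FinProb.expect P f = p * f 0 + (1 - p) * f m')
    (G : Matrix (Fin K) (Fin N) F) :
    (scheme M N K F hKN P).rate G =
      (1 + (1 - p) * ∑ i ∈ Finset.Icc 1 (M - 1), ((K : ℝ) / N) ^ i)⁻¹ := by
  have hN : (N : ℝ) ≠ 0 := NeZero.ne _
  have hK' : (K : ℝ) ≠ 0 := by
    rw [Nat.cast_ne_zero]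
    lia
  have hgeom : ∑ i ∈ Finset.range M, ((K : ℝ) / N) ^ i =
      1 + ∑ i ∈ Finset.Icc 1 (M - 1), ((K : ℝ) / N) ^ i := by
    rw [← hm, Finset.sum_range_succ', pow_zero, add_comm, Finset.range_eq_Ico,
      Finset.sum_Ico_add' (fun i => ((K : ℝ) / N) ^ i) 0 _ 1]
    rfl
  have hpos : (N : ℝ) * (Fintype.card (BU.Pos N K ((m' : ℕ) + 1)) * N ^ (M - ((m' : ℕ) + 1))) =
      K * N ^ M * (1 + ∑ i ∈ Finset.Icc 1 (M - 1), ((K : ℝ) / N) ^ i) := by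
    rw [← hgeom, card_pos _ hKN]
    push_cast
    -- With all `M` files involved, a super-row is a single row.
    rw [Fin.sum_univ_eq_sum_range (fun i => (K : ℝ) ^ i * (N : ℝ) ^ ((m' : ℕ) - i)), hm,
      Nat.sub_self, pow_zero, mul_one, mul_left_comm, mul_assoc]
    congr 1
    rw [Finset.mul_sum, Finset.mul_sum]
    refine Finset.sum_congr rfl fun i hi => ?_
    have hi' := Finset.mem_range.1 hi
    rw [div_pow, show (N : ℝ) ^ M = N ^ ((m' : ℕ) - i + i + 1) by congr 1; lia]
    field_simp
    ring
  rw [IRScheme.rate_eq_div _ G (d := K * N ^ M * (1 + (1 - p) *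
    ∑ i ∈ Finset.Icc 1 (M - 1), ((K : ℝ) / N) ^ i))]
  · push_cast
    rw [mul_comm ((N : ℝ) ^ M), div_mul_cancel_left₀ (by positivity)]
  · intro θ W
    refine (expect_queryLaw hP θ
      (expect_length_answer (hKN := hKN) θ fun l => stored G W l)).trans ?_
    rw [if_pos (Fin.val_zero M), if_neg h0, hpos]
    ring

end WBU

end

theorem theorem3 (M N K : ℕ) [NeZero M] (hM : 2 ≤ M) (hK : 1 ≤ K) (hKN : K ≤ N)
    (ρ : ℝ) (hρ : 0 ≤ ρ) :
    ∃ P : PMF (Fin M), ∀ (F : Type*) [Field F] [Fintype F] (G : Matrix (Fin K) (Fin N) F),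
      IsMDS G →
        (WBU.scheme M N K F hKN P).clientResidualEntropy G = 0 ∧
        (K < N → (WBU.scheme M N K F hKN P).residualEntropy G = 0) ∧
        (WBU.scheme M N K F hKN P).mil = min ρ (K * Real.logb 2 M / N) ∧
        (WBU.scheme M N K F hKN P).rate G =
          (1 + max 0 (1 - N * ρ / (K * Real.logb 2 M)) *
            ∑ i ∈ Finset.Icc 1 (M - 1), ((K : ℝ) / N) ^ i)⁻¹ := by
  have : NeZero N := ⟨by lia⟩
  have hN' : (0 : ℝ) < N := by exact_mod_cast hK.trans hKN
  have hK' : (0 : ℝ) < K := by exact_mod_cast hK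
  have hlog : 0 < Real.logb 2 M := Real.logb_pos one_lt_two (by exact_mod_cast hM)
  -- At `p = t` the leakage `p * K * log M / N` equals `ρ`; capping `p` at `1` produces the minimum
  -- in the leakage and the positive part in the rate.
  set t := N * ρ / (K * Real.logb 2 M) with ht
  have ht0 : 0 ≤ t := by positivity
  have hp : 1 - min t 1 = max 0 (1 - t) := by
    rcases le_total t 1 with h | h
    · rw [min_eq_left h, max_eq_right (sub_nonneg.2 h)]
    · rw [min_eq_right h, max_eq_left (sub_nonpos.2 h), sub_self]
  let m' : Fin M := ⟨M - 1, by lia⟩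
  have hm : (m' : ℕ) + 1 = M := Nat.sub_add_cancel (by lia)
  have h0 : (m' : ℕ) ≠ 0 := by lia
  obtain ⟨P, hP⟩ := FinProb.exists_pmf_expect_eq (0 : Fin M) m'
    (le_min ht0 zero_le_one) (min_le_right t 1)
  refine ⟨P, fun F _ _ G hG => ⟨?_, fun hlt => ?_, ?_, ?_⟩⟩
  · refine FinProb.condEntropy_eq_zero ?_
    rintro ⟨θ, W, q⟩ hω ⟨θ', W', q'⟩ hω' he
    simp only [Prod.mk.injEq] at he
    obtain ⟨ha, rfl, rfl⟩ := he
    exact WBU.decode (hKN := hKN) hG (IRScheme.mem_support_queryLaw hω) (congrFun ha)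
  · refine FinProb.condEntropy_eq_zero ?_
    rintro ⟨θ, W, q⟩ hω ⟨θ', W', q'⟩ hω' he
    simp only [Prod.mk.injEq] at he
    obtain ⟨ha, rfl⟩ := he
    -- Here `θ` is not part of the conditioning and is recovered from the queries.
    obtain rfl : θ = θ' := WBU.index_unique (hKN := hKN) hK hlt (IRScheme.mem_support_queryLaw hω)
      (IRScheme.mem_support_queryLaw hω')
    exact WBU.decode (hKN := hKN) hG (IRScheme.mem_support_queryLaw hω) (congrFun ha)
  · have hc : 0 ≤ (K : ℝ) * Real.logb 2 M / N := by positivity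
    rw [WBU.mil_eq hm h0 hP, mul_assoc, mul_div_assoc, min_mul_of_nonneg _ _ hc, one_mul, ht]
    congr 1
    field_simp
  · rw [WBU.rate_eq hK hm h0 hP, hp]
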